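/- Let $W=S_n$ with simple generators $s_i=(i\ i{+}1)$, length function $\ell$, and reflections the conjugates of the $s_i$. Bruhat order on $W$ is the partial order with $x\le y$ if and only if there is a directed path from $x$ to $y$ along edges $a\to b$, where $ba^{-1}$ is a reflection and $\ell(a)<\ell(b)$; write $[u,v]=\{y : u\le y\le v\}$. Let $(R_{u,v})_{u,v\in W}$ be the Kazhdan--Lusztig $R$-polynomials, i.e. the unique family in $\mathbb{Z}[q]$ with $R_{u,v}=0$ if $u\not\le v$, $R_{u,u}=1$, and, for $u<v$ and any simple $s$ with $sv<v$, $R_{u,v}=R_{su,sv}$ if $su<u$ and $R_{u,v}=(q-1)R_{u,sv}+qR_{su,sv}$ if $su>u$. Let $\widetilde R_{u,v}\in\mathbb{Z}[q]$ be the unique polynomial with $$R_{u,v}(q)=q^{(\ell(v)-\ell(u))/2}\,\widetilde R_{u,v}(q^{1/2}-q^{-1/2}).$$ For $u\le v$, a nonempty order ideal (down-closed subset) $I$ of $[u,v]$ and $y\in[u,v]$, put $$\widetilde R_{u,y,I}(q)=\sum_{x\in I\cap[u,y]}\widetilde R_{u,x}(-q)\,\widetilde R_{x,y}(q).$$ **Lemma.**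 Let $u\le v$ in $S_n$ and let $I$ be a nonempty proper order ideal of $[u,v]$ (that is, $\varnothing\ne I\neq[u,v]$). Then $$\sum_{y\in[u,v]}\widetilde R_{u,y,I}(-q)\,\widetilde R_{y,v}(q)=0.$$ -/

import Mathlib

open Polynomial

namespace SymBruhat

/-- The simple generators `s_i = (i i+1)` of the symmetric group on `Fin n`. -/
def simples (n : ℕ) : Set (Equiv.Perm (Fin n)) :=
  {s | ∃ i j : Fin n, (j : ℕ) = (i : ℕ) + 1 ∧ s = Equiv.swap i j}

/-- The Coxeter length: the least number of factors in a word in the simple generators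
with product `w`. -/
noncomputable def length {n : ℕ} (w : Equiv.Perm (Fin n)) : ℕ :=
  sInf {k | ∃ l : List (Equiv.Perm (Fin n)), (∀ s ∈ l, s ∈ simples n) ∧ l.prod = w ∧ l.length = k}

/-- Reflections are the conjugates of the simple generators. -/
def IsReflection {n : ℕ} (t : Equiv.Perm (Fin n)) : Prop :=
  ∃ s ∈ simples n, ∃ w : Equiv.Perm (Fin n), t = w * s * w⁻¹

/-- The edges `x → y` of the Bruhat graph. -/
def Edge {n : ℕ} (x y : Equiv.Perm (Fin n)) : Prop :=
  IsReflection (y * x⁻¹) ∧ length x < length y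

/-- Bruhat order: `x ≤ y` if there is a directed path from `x` to `y` in the Bruhat graph. -/
def LE {n : ℕ} (x y : Equiv.Perm (Fin n)) : Prop :=
  Relation.ReflTransGen Edge x y

/-- Strict Bruhat order. -/
def LT {n : ℕ} (x y : Equiv.Perm (Fin n)) : Prop :=
  LE x y ∧ x ≠ y

open Classical in
/-- The Bruhat interval `[u, v]`. -/
noncomputable def interval {n : ℕ} (u v : Equiv.Perm (Fin n)) : Finset (Equiv.Perm (Fin n)) :=
  Finset.univ.filter (fun y => LE u y ∧ LE y v)

/-- The Kazhdan–Lusztig characterization of the family of `R`-polynomials (in `q = X`). -/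
structure IsRFamily (n : ℕ)
    (R : Equiv.Perm (Fin n) → Equiv.Perm (Fin n) → ℤ[X]) : Prop where
  of_not_le : ∀ u v, ¬ LE u v → R u v = 0
  self : ∀ u, R u u = 1
  of_descent : ∀ u v, LT u v → ∀ s ∈ simples n, LT (s * v) v →
    LT (s * u) u → R u v = R (s * u) (s * v)
  of_ascent : ∀ u v, LT u v → ∀ s ∈ simples n, LT (s * v) v →
    LT u (s * u) → R u v = (X - 1) * R u (s * v) + X * R (s * u) (s * v)

/-- The `R`-polynomials: the unique family with the Kazhdan–Lusztig properties. -/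
noncomputable def R {n : ℕ} : Equiv.Perm (Fin n) → Equiv.Perm (Fin n) → ℤ[X] :=
  Classical.epsilon (IsRFamily n)

/-- `P` satisfies `R_{u,v}(q) = q^{ℓ(u,v)/2} P(q^{1/2} - q^{-1/2})`, where
`ℓ(u,v) = ℓ(v) - ℓ(u)`. This is an identity of Laurent polynomials in `T = q^{1/2}`. -/
def IsRTilde {n : ℕ} (u v : Equiv.Perm (Fin n)) (P : ℤ[X]) : Prop :=
  aeval (LaurentPolynomial.T 2 : LaurentPolynomial ℤ) (R u v) =
    LaurentPolynomial.T ((length v : ℤ) - (length u : ℤ)) *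
      aeval (LaurentPolynomial.T 1 - LaurentPolynomial.T (-1) : LaurentPolynomial ℤ) P

/-- The `R̃`-polynomial of `u, v`: the unique polynomial with the property `IsRTilde u v`. -/
noncomputable def RTilde {n : ℕ} (u v : Equiv.Perm (Fin n)) : ℤ[X] :=
  Classical.epsilon (IsRTilde u v)

/-- `I` is an order ideal (a down-closed subset) of the poset `[u, v]`. -/
def IsOrderIdeal {n : ℕ} (u v : Equiv.Perm (Fin n)) (I : Finset (Equiv.Perm (Fin n))) : Prop :=
  I ⊆ interval u v ∧ ∀ x ∈ interval u v, ∀ y ∈ I, LE x y → x ∈ I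

/-- The relative polynomial `R̃_{u,y,I} = ∑_{x ∈ I ∩ [u,y]} R̃_{u,x}(-q) R̃_{x,y}(q)`. -/
noncomputable def relRTilde {n : ℕ} (u y : Equiv.Perm (Fin n))
    (I : Finset (Equiv.Perm (Fin n))) : ℤ[X] :=
  ∑ x ∈ I ∩ interval u y, (RTilde u x).comp (-X) * RTilde x y

end SymBruhat

namespace SymBruhat

/-! Replacing q by -q in the relative polynomial and exchanging the sums turns the left side into
the sum over x in I of R̃_{u,x}(q) · ∑_y R̃_{x,y}(-q) R̃_{y,v}(q). By the inversion formula
`sum_RTilde_comp_neg_mul` the inner sum is δ_{x,v}, and v ∉ I because a down-closed set containing v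
is all of [u,v].

The inversion formula needs the left recursion for R̃ at every descent, while R and R̃ are given
only by choice. So a solution `coeff a b` of the recursion is built over any commutative ring. It
imitates right multiplication in a Hecke algebra: left and right operators commute
(`leftOp_rightOp`), which makes the recursion independent of the chosen descent. Parameters (q-1, q)
give R by uniqueness, and (q, 1) give R̃. -/

open Equiv

variable {n : ℕ}

/-! ### Inversions and Coxeter length -/

/-- The inversions of `w`, as pairs of values. -/
def inversions (w : Perm (Fin n)) : Finset (Fin n × Fin n) :=
  Finset.univ.filter fun p => p.1 < p.2 ∧ w⁻¹ p.2 < w⁻¹ p.1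

/-- The number of inversions of `w`. -/
def inv (w : Perm (Fin n)) : ℕ := (inversions w).card

lemma mem_inversions {w : Perm (Fin n)} {p : Fin n × Fin n} :
    p ∈ inversions w ↔ p.1 < p.2 ∧ w⁻¹ p.2 < w⁻¹ p.1 := by
  simp [inversions]

lemma swap_mul_inv_apply (a b c : Fin n) (x : Perm (Fin n)) :
    (swap a b * x)⁻¹ c = x⁻¹ (swap a b c) := by
  simp [mul_inv_rev]

lemma inv_lt_inv_swap_mul {a b : Fin n} (hab : a < b) {x : Perm (Fin n)}
    (h : x⁻¹ a < x⁻¹ b) : inv x < inv (swap a b * x) := by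
  have key : ∀ c d : Fin n, c < d → ¬ swap a b c < swap a b d →
      (c = a ∧ d ≤ b ∧ (d ≠ b → swap a b d = d)) ∨
      (d = b ∧ a ≤ c ∧ (c ≠ a → swap a b c = c)) := by
    intro c d hcd hn
    simp only [swap_apply_def] at hn ⊢
    grind
  -- The map transports a pair by the transposition when that keeps its order and fixes it
  -- otherwise; it is injective and misses the new inversion (a, b).
  let φ : Fin n × Fin n → Fin n × Fin n := fun p =>
    if swap a b p.1 < swap a b p.2 then (swap a b p.1, swap a b p.2) else p
  have hmem : (a, b) ∈ inversions (swap a b * x) := by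
    rw [mem_inversions]
    simp only [swap_mul_inv_apply, swap_apply_left, swap_apply_right]
    exact ⟨hab, h⟩
  have hmaps : ∀ p ∈ inversions x, φ p ∈ (inversions (swap a b * x)).erase (a, b) := by
    rintro ⟨c, d⟩ hp
    rw [mem_inversions] at hp
    obtain ⟨hcd, hx⟩ := hp
    simp only at hcd hx
    rw [Finset.mem_erase, mem_inversions]
    simp only [swap_mul_inv_apply, φ]
    by_cases ht : swap a b c < swap a b d
    · simp only [ht, if_true, swap_apply_self, ne_eq, Prod.mk.injEq]
      refine ⟨?_, trivial, hx⟩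
      rintro ⟨h1, h2⟩
      have h1' : c = b := by
        rw [← swap_apply_self a b c, h1, swap_apply_left]
      have h2' : d = a := by
        rw [← swap_apply_self a b d, h2, swap_apply_right]
      subst h1' h2'
      exact lt_asymm hab hcd
    · simp only [ht, if_false, ne_eq, Prod.mk.injEq]
      rcases key c d hcd ht with ⟨rfl, hd, hd'⟩ | ⟨rfl, hc, hc'⟩
      · have hdb : d ≠ b := by
          rintro rfl
          exact lt_asymm h hx
        rw [hd' hdb, swap_apply_left]
        exact ⟨fun e => hdb e.2, hcd, hx.trans h⟩
      · have hca : c ≠ a := by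
          rintro rfl
          exact lt_asymm h hx
        rw [hc' hca, swap_apply_right]
        exact ⟨fun e => hca e.1, hcd, h.trans hx⟩
  have hinj : Set.InjOn φ (inversions x) := by
    rintro ⟨c, d⟩ hp ⟨c', d'⟩ hp' he
    have h1 := (mem_inversions.1 hp).1
    have h2 := (mem_inversions.1 hp').1
    simp only [φ] at he h1 h2
    split_ifs at he with h3 h4 h4
    · simpa using he
    · simp only [Prod.mk.injEq] at he
      rw [← he.1, ← he.2, swap_apply_self, swap_apply_self] at h4
      exact absurd h1 h4
    · simp only [Prod.mk.injEq] at he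
      rw [he.1, he.2, swap_apply_self, swap_apply_self] at h3
      exact absurd h2 h3
    · exact he
  exact (Finset.card_le_card_of_injOn φ hmaps hinj).trans_lt (Finset.card_erase_lt_of_mem hmem)

lemma swap_lt_swap_iff {i j : Fin n} (hij : (j : ℕ) = i + 1) {p q : Fin n}
    (h1 : ¬ (p = i ∧ q = j)) (h2 : ¬ (p = j ∧ q = i)) :
    swap i j p < swap i j q ↔ p < q := by
  simp only [swap_apply_def, Fin.lt_def, Fin.ext_iff] at *
  split_ifs <;> omega

lemma inv_swap_mul_le {i j : Fin n} (hij : (j : ℕ) = i + 1) (x : Perm (Fin n)) :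
    inv (swap i j * x) ≤ inv x + 1 := by
  have hle : ((inversions (swap i j * x)).erase (i, j)).card ≤ (inversions x).card := by
    refine Finset.card_le_card_of_injOn (fun p => (swap i j p.1, swap i j p.2)) ?_ ?_
    · rintro ⟨c, d⟩ hp
      simp only [Finset.coe_erase, Set.mem_sdiff, Finset.mem_coe, mem_inversions,
        swap_mul_inv_apply, Set.mem_singleton_iff, Prod.mk.injEq] at hp
      rw [Finset.mem_coe, mem_inversions]
      refine ⟨(swap_lt_swap_iff hij hp.2 ?_).2 hp.1.1, hp.1.2⟩
      rintro ⟨rfl, rfl⟩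
      have := Fin.lt_def.1 hp.1.1
      omega
    · rintro ⟨c, d⟩ _ ⟨c', d'⟩ _ he
      simpa using he
  have := Finset.pred_card_le_card_erase (s := inversions (swap i j * x)) (a := (i, j))
  unfold inv
  omega

lemma lt_of_val_eq {i j : Fin n} (hij : (j : ℕ) = i + 1) : i < j := by
  rw [Fin.lt_def]; omega

lemma inv_of_ascent {i j : Fin n} (hij : (j : ℕ) = i + 1) {x : Perm (Fin n)}
    (h : x⁻¹ i < x⁻¹ j) : inv (swap i j * x) = inv x + 1 :=
  le_antisymm (inv_swap_mul_le hij x) (inv_lt_inv_swap_mul (lt_of_val_eq hij) h)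

lemma inv_of_descent {i j : Fin n} (hij : (j : ℕ) = i + 1) {x : Perm (Fin n)}
    (h : x⁻¹ j < x⁻¹ i) : inv x = inv (swap i j * x) + 1 := by
  have := inv_of_ascent hij (x := swap i j * x) (by simpa using h)
  simpa using this

lemma descent_or_ascent {i j : Fin n} (hij : (j : ℕ) = i + 1) (x : Perm (Fin n)) :
    x⁻¹ j < x⁻¹ i ∨ x⁻¹ i < x⁻¹ j := by
  refine lt_or_gt_of_ne fun h => ?_
  have := x⁻¹.injective h
  have := lt_of_val_eq hij
  simp_all

lemma inv_one : inv (1 : Perm (Fin n)) = 0 := by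
  rw [inv, Finset.card_eq_zero, Finset.eq_empty_iff_forall_notMem]
  intro p hp
  rw [mem_inversions] at hp
  exact lt_asymm hp.1 (by simpa using hp.2)

lemma eq_one_of_no_descent {x : Perm (Fin n)}
    (h : ∀ i j : Fin n, (j : ℕ) = i + 1 → x⁻¹ i < x⁻¹ j) : x = 1 := by
  cases n with
  | zero => exact Subsingleton.elim _ _
  | succ n =>
    have hm : StrictMono (x⁻¹ : Perm (Fin (n + 1))) :=
      Fin.strictMono_iff_lt_succ.2 fun i => h _ _ (by simp)
    -- A finite chain has only one order automorphism.
    have he : StrictMono.orderIsoOfSurjective _ hm x⁻¹.surjective = OrderIso.refl _ :=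
      Subsingleton.elim _ _
    have : x⁻¹ = 1 := by
      ext k
      have := congrArg (fun e : Fin (n + 1) ≃o Fin (n + 1) => ((e k : Fin (n + 1)) : ℕ)) he
      simpa using this
    simpa using this

lemma exists_descent {x : Perm (Fin n)} (h : x ≠ 1) :
    ∃ i j : Fin n, (j : ℕ) = i + 1 ∧ x⁻¹ j < x⁻¹ i := by
  by_contra! hc
  refine h (eq_one_of_no_descent fun i j hij => ?_)
  exact (descent_or_ascent hij x).resolve_left (not_lt.2 (hc i j hij))

lemma exists_ascent {x : Perm (Fin n)} (h : x ≠ Fin.revPerm) :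
    ∃ i j : Fin n, (j : ℕ) = i + 1 ∧ x⁻¹ i < x⁻¹ j := by
  have h' : x * Fin.revPerm⁻¹ ≠ 1 := fun e => h (mul_inv_eq_one.1 e)
  obtain ⟨i, j, hij, hd⟩ := exists_descent h'
  refine ⟨i, j, hij, ?_⟩
  simpa [mul_inv_rev, Fin.rev_lt_rev] using hd

/-- A descent removes exactly one inversion, which yields a word with `inv w` letters; a generator
adds at most one, so no word is shorter. -/
lemma length_eq_inv (w : Perm (Fin n)) : length w = inv w := by
  have hex : ∀ k (w : Perm (Fin n)), inv w = k → ∃ l : List (Perm (Fin n)),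
      (∀ s ∈ l, s ∈ simples n) ∧ l.prod = w ∧ l.length = k := by
    intro k
    induction k with
    | zero =>
      intro w hw
      have : w = 1 := by
        by_contra h
        obtain ⟨i, j, hij, hd⟩ := exists_descent h
        have := inv_of_descent hij hd
        omega
      exact ⟨[], by simp, by simp [this], rfl⟩
    | succ k ih =>
      intro w hw
      have hne : w ≠ 1 := by
        rintro rfl
        rw [inv_one] at hw
        omega
      obtain ⟨i, j, hij, hd⟩ := exists_descent hne
      obtain ⟨l, hl, hp, hlen⟩ := ih (swap i j * w) (by
        have := inv_of_descent hij hd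
        omega)
      refine ⟨swap i j :: l, ?_, by simp [hp], by simp [hlen]⟩
      intro s hs
      rcases List.mem_cons.1 hs with rfl | hs
      · exact ⟨i, j, hij, rfl⟩
      · exact hl s hs
  have hle : ∀ l : List (Perm (Fin n)), (∀ s ∈ l, s ∈ simples n) → inv l.prod ≤ l.length := by
    intro l
    induction l with
    | nil => intro _; simp [inv_one]
    | cons s l ih =>
      intro hl
      obtain ⟨i, j, hij, rfl⟩ := hl s (by simp)
      have h1 := ih fun t ht => hl t (by simp [ht])
      have h2 := inv_swap_mul_le hij l.prod
      simp only [List.prod_cons, List.length_cons]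
      omega
  refine le_antisymm (Nat.sInf_le (hex _ w rfl)) ?_
  obtain ⟨l, hl, hp, hlen⟩ := Nat.sInf_mem (s := {k | ∃ l : List (Perm (Fin n)),
    (∀ s ∈ l, s ∈ simples n) ∧ l.prod = w ∧ l.length = k}) ⟨_, hex _ w rfl⟩
  unfold length
  rw [← hlen, ← hp]
  exact hle l hl

/-! ### Bruhat edges and the lifting property -/

lemma isReflection_conj {t : Perm (Fin n)} (h : IsReflection t) (w : Perm (Fin n)) :
    IsReflection (w * t * w⁻¹) := by
  obtain ⟨s, hs, x, rfl⟩ := h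
  exact ⟨s, hs, w * x, by simp [mul_assoc]⟩

lemma isReflection_swap {i j : Fin n} (hij : (j : ℕ) = i + 1) : IsReflection (swap i j) :=
  ⟨_, ⟨i, j, hij, rfl⟩, 1, by simp⟩

lemma IsReflection.exists_swap {t : Perm (Fin n)} (h : IsReflection t) :
    ∃ a b : Fin n, a < b ∧ t = swap a b := by
  obtain ⟨s, ⟨i, j, hij, rfl⟩, w, rfl⟩ := h
  rw [← swap_apply_apply]
  rcases lt_or_gt_of_ne (w.injective.ne (lt_of_val_eq hij).ne) with h | h
  · exact ⟨_, _, h, rfl⟩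
  · exact ⟨_, _, h, swap_comm _ _⟩

lemma Edge.exists_swap {x y : Perm (Fin n)} (h : Edge x y) :
    ∃ a b : Fin n, a < b ∧ y = swap a b * x ∧ x⁻¹ a < x⁻¹ b := by
  obtain ⟨a, b, hab, ht⟩ := h.1.exists_swap
  have hy : y = swap a b * x := by rw [← ht]; simp
  refine ⟨a, b, hab, hy, ?_⟩
  by_contra hc
  have hlt : x⁻¹ b < x⁻¹ a := lt_of_le_of_ne (not_lt.1 hc) (x⁻¹.injective.ne hab.ne')
  have h1 := inv_lt_inv_swap_mul hab (x := y) (by rw [hy]; simpa using hlt)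
  have h2 := h.2
  rw [length_eq_inv, length_eq_inv] at h2
  rw [hy] at h1 h2
  simp only [swap_mul_self_mul] at h1
  omega

lemma edge_of_ascent {i j : Fin n} (hij : (j : ℕ) = i + 1) {x : Perm (Fin n)}
    (h : x⁻¹ i < x⁻¹ j) : Edge x (swap i j * x) := by
  refine ⟨by simpa using isReflection_swap hij, ?_⟩
  rw [length_eq_inv, length_eq_inv, inv_of_ascent hij h]
  omega

/-- The transposition (i j) of neighbours preserves the order of every pair except (i, j) itself, so
only the edge x → s x can be reversed. -/
lemma Edge.lift {i j : Fin n} (hij : (j : ℕ) = i + 1) {x y : Perm (Fin n)} (h : Edge x y) :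
    y = swap i j * x ∨ Edge (swap i j * x) (swap i j * y) := by
  obtain ⟨a, b, hab, hy, hlt⟩ := h.exists_swap
  by_cases hc : a = i ∧ b = j
  · left
    rw [hy, hc.1, hc.2]
  right
  have hs : swap i j a < swap i j b := (swap_lt_swap_iff hij hc (by
    rintro ⟨rfl, rfl⟩
    exact lt_asymm hab (lt_of_val_eq hij))).2 hab
  refine ⟨?_, ?_⟩
  · have := isReflection_conj h.1 (swap i j)
    simpa [mul_assoc] using this
  · have h1 := inv_lt_inv_swap_mul hs (x := swap i j * x) (by simpa using hlt)
    have h2 : swap (swap i j a) (swap i j b) * (swap i j * x) = swap i j * y := by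
      rw [swap_apply_apply, hy]
      simp [mul_assoc]
    rw [h2] at h1
    rwa [length_eq_inv, length_eq_inv]

lemma LE.length_le {x y : Perm (Fin n)} (h : LE x y) : length x ≤ length y := by
  induction h with
  | refl => exact le_rfl
  | tail _ h ih => exact ih.trans h.2.le

lemma LT.length_lt {x y : Perm (Fin n)} (h : LT x y) : length x < length y := by
  obtain ⟨h, hne⟩ := h
  rcases Relation.ReflTransGen.cases_head h with rfl | ⟨z, hz, hzy⟩
  · exact absurd rfl hne
  · exact hz.2.trans_le (LE.length_le hzy)

lemma lt_iff_descent {i j : Fin n} (hij : (j : ℕ) = i + 1) {x : Perm (Fin n)} :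
    LT (swap i j * x) x ↔ x⁻¹ j < x⁻¹ i := by
  constructor
  · intro h
    refine (descent_or_ascent hij x).resolve_right fun ha => ?_
    have h1 := h.length_lt
    rw [length_eq_inv, length_eq_inv, inv_of_ascent hij ha] at h1
    omega
  · intro h
    have := edge_of_ascent hij (x := swap i j * x) (by simpa using h)
    simp only [swap_mul_self_mul] at this
    refine ⟨.single this, fun e => ?_⟩
    have := this.2
    rw [e] at this
    omega

lemma lt_iff_ascent {i j : Fin n} (hij : (j : ℕ) = i + 1) {x : Perm (Fin n)} :
    LT x (swap i j * x) ↔ x⁻¹ i < x⁻¹ j := by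
  have := lt_iff_descent hij (x := swap i j * x)
  simpa using this

lemma LE.lift {i j : Fin n} (hij : (j : ℕ) = i + 1) {x w : Perm (Fin n)} (h : LE x w)
    (hw : w⁻¹ i < w⁻¹ j) : LE (swap i j * x) (swap i j * w) := by
  induction h using Relation.ReflTransGen.head_induction_on with
  | refl => exact .refl
  | head h hyw ih =>
    rcases h.lift hij with rfl | h
    · exact Relation.ReflTransGen.tail hyw (edge_of_ascent hij hw)
    · exact Relation.ReflTransGen.head h ih

/-! ### Commuting left and right operators -/

variable {K : Type*} [CommRing K]

/-- The operator on functions on `S_n` given by the left recursion with parameters `a`, `b`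
along `s = (i j)`. -/
def leftOp (a b : K) (i j : Fin n) (f : Perm (Fin n) → K) (u : Perm (Fin n)) : K :=
  if u⁻¹ j < u⁻¹ i then f (swap i j * u) else a * f u + b * f (swap i j * u)

/-- The right-hand analogue of `leftOp`. -/
def rightOp (a b : K) (i j : Fin n) (f : Perm (Fin n) → K) (u : Perm (Fin n)) : K :=
  if u j < u i then f (u * swap i j) else a * f u + b * f (u * swap i j)

lemma leftOp_of_descent {a b : K} {i j : Fin n} {f : Perm (Fin n) → K} {u : Perm (Fin n)}
    (h : u⁻¹ j < u⁻¹ i) : leftOp a b i j f u = f (swap i j * u) :=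
  if_pos h

lemma leftOp_of_ascent {a b : K} {i j : Fin n} {f : Perm (Fin n) → K} {u : Perm (Fin n)}
    (h : u⁻¹ i < u⁻¹ j) : leftOp a b i j f u = a * f u + b * f (swap i j * u) :=
  if_neg h.not_gt

/-- If s u = u t, both operators act identically on functions on {u, s u}. Otherwise neither
multiplication changes the other side's descent test, and the operators commute term by term. -/
lemma leftOp_rightOp (a b : K) {i j k l : Fin n} (hij : (j : ℕ) = i + 1)
    (hkl : (l : ℕ) = k + 1) (f : Perm (Fin n) → K) :
    leftOp a b i j (rightOp a b k l f) = rightOp a b k l (leftOp a b i j f) := by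
  funext u
  have hlt := lt_of_val_eq hij
  have hlt' := lt_of_val_eq hkl
  have hs : swap (u k) (u l) * u = u * swap k l := (mul_swap_eq_swap_mul u k l).symm
  have hs' : swap (u k) (u l) * (u * swap k l) = u := by rw [← hs, swap_mul_self_mul]
  by_cases h1 : u⁻¹ i = k ∧ u⁻¹ j = l
  · obtain ⟨rfl, rfl⟩ : i = u k ∧ j = u l := by simp [← h1.1, ← h1.2]
    simp [leftOp, rightOp, hs, hs', mul_assoc, hlt, hlt', hlt.not_gt, hlt'.not_gt]
  by_cases h2 : u⁻¹ i = l ∧ u⁻¹ j = k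
  · obtain ⟨rfl, rfl⟩ : i = u l ∧ j = u k := by simp [← h2.1, ← h2.2]
    rw [swap_comm] at hs hs'
    simp [leftOp, rightOp, hs, hs', mul_assoc, hlt, hlt', hlt.not_gt, hlt'.not_gt]
  have e1 : (u * swap k l)⁻¹ j < (u * swap k l)⁻¹ i ↔ u⁻¹ j < u⁻¹ i := by
    simp only [mul_inv_rev, swap_inv, Perm.mul_apply]
    exact swap_lt_swap_iff hkl (fun h => h2 h.symm) (fun h => h1 h.symm)
  have e2 : (swap i j * u) l < (swap i j * u) k ↔ u l < u k := by
    simp only [Perm.mul_apply]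
    refine swap_lt_swap_iff hij ?_ ?_
    · rintro ⟨rfl, rfl⟩; simp at h2
    · rintro ⟨rfl, rfl⟩; simp at h1
  simp only [leftOp, rightOp, e1, e2, mul_assoc]
  split_ifs <;> ring

/-- Operators commuting with every `leftOp` agree as soon as they agree at the longest element. -/
lemma eq_of_commute_leftOp (a b : K)
    {Φ Ψ : (Perm (Fin n) → K) → Perm (Fin n) → K}
    (hΦ : ∀ i j : Fin n, (j : ℕ) = i + 1 → ∀ f, Φ (leftOp a b i j f) = leftOp a b i j (Φ f))
    (hΨ : ∀ i j : Fin n, (j : ℕ) = i + 1 → ∀ f, Ψ (leftOp a b i j f) = leftOp a b i j (Ψ f))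
    (h : ∀ f, Φ f Fin.revPerm = Ψ f Fin.revPerm) : Φ = Ψ := by
  have hb : ∀ u : Perm (Fin n), inv u ≤ (Finset.univ : Finset (Fin n × Fin n)).card :=
    fun u => Finset.card_le_card (Finset.subset_univ _)
  have key : ∀ k (u : Perm (Fin n)), (Finset.univ : Finset (Fin n × Fin n)).card - inv u = k →
      ∀ f, Φ f u = Ψ f u := by
    intro k
    induction k using Nat.strong_induction_on with
    | _ k ih =>
      intro u hk f
      by_cases hu : u = Fin.revPerm
      · rw [hu, h]
      obtain ⟨i, j, hij, ha⟩ := exists_ascent hu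
      have hd : (swap i j * u)⁻¹ j < (swap i j * u)⁻¹ i := by simpa using ha
      -- At the descent s u, `leftOp` just reads off the value at u, so values at u reduce to values
      -- at the longer element s u.
      have h1 : Φ f u = Φ (leftOp a b i j f) (swap i j * u) := by
        rw [hΦ i j hij, leftOp_of_descent hd, swap_mul_self_mul]
      have h2 : Ψ f u = Ψ (leftOp a b i j f) (swap i j * u) := by
        rw [hΨ i j hij, leftOp_of_descent hd, swap_mul_self_mul]
      rw [h1, h2]
      have := inv_of_ascent hij ha
      have := hb (swap i j * u)
      exact ih _ (by omega) _ rfl _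
  funext f u
  exact key _ u rfl f

/-! ### Solving the recursion -/

/-- `Φ` commutes with the left operators and translates the value at the longest element by
`v⁻¹`. -/
structure IsRightMul (a b : K) (v : Perm (Fin n))
    (Φ : (Perm (Fin n) → K) → Perm (Fin n) → K) : Prop where
  comm : ∀ i j : Fin n, (j : ℕ) = i + 1 → ∀ f, Φ (leftOp a b i j f) = leftOp a b i j (Φ f)
  top : ∀ f, Φ f Fin.revPerm = f (Fin.revPerm * v⁻¹)

lemma IsRightMul.step {a b : K} {v : Perm (Fin n)} {i j : Fin n} (hij : (j : ℕ) = i + 1)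
    (hd : v⁻¹ j < v⁻¹ i) {Φ : (Perm (Fin n) → K) → Perm (Fin n) → K}
    (h : IsRightMul a b (swap i j * v) Φ) : IsRightMul a b v (fun f => Φ (rightOp a b i j f)) := by
  refine ⟨fun k l hkl f => ?_, fun f => ?_⟩
  · rw [← leftOp_rightOp a b hkl hij, h.comm k l hkl]
  · rw [h.top, rightOp, if_pos (by simpa [mul_inv_rev, Fin.rev_lt_rev] using hd)]
    simp [mul_inv_rev, mul_assoc]

lemma exists_isRightMul (a b : K) (v : Perm (Fin n)) : ∃ Φ, IsRightMul a b v Φ := by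
  induction hk : inv v using Nat.strong_induction_on generalizing v with
  | _ k ih =>
    by_cases hv : v = 1
    · exact ⟨id, fun _ _ _ _ => rfl, fun f => by simp [hv]⟩
    obtain ⟨i, j, hij, hd⟩ := exists_descent hv
    have := inv_of_descent hij hd
    obtain ⟨Φ, hΦ⟩ := ih _ (by omega) (swap i j * v) rfl
    exact ⟨_, hΦ.step hij hd⟩

/-- Right multiplication by the basis element of `v`, as an operator on functions. -/
noncomputable def rightMul (a b : K) (v : Perm (Fin n)) :
    (Perm (Fin n) → K) → Perm (Fin n) → K :=
  (exists_isRightMul a b v).choose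

lemma rightMul_spec (a b : K) (v : Perm (Fin n)) : IsRightMul a b v (rightMul a b v) :=
  (exists_isRightMul a b v).choose_spec

lemma IsRightMul.eq {a b : K} {v : Perm (Fin n)}
    {Φ Ψ : (Perm (Fin n) → K) → Perm (Fin n) → K}
    (hΦ : IsRightMul a b v Φ) (hΨ : IsRightMul a b v Ψ) : Φ = Ψ :=
  eq_of_commute_leftOp a b hΦ.comm hΨ.comm fun f => by rw [hΦ.top, hΨ.top]

/-- The solution of the left recursion with parameters `a`, `b`, as a function `u ↦ coeff u v`. -/
noncomputable def coeff (a b : K) (u v : Perm (Fin n)) : K :=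
  rightMul a b v (Pi.single 1 1) u

lemma coeff_one (a b : K) : (fun u => coeff a b u (1 : Perm (Fin n))) = Pi.single 1 1 := by
  have h : IsRightMul a b (1 : Perm (Fin n)) id := ⟨fun _ _ _ _ => rfl, fun f => by simp⟩
  funext u
  rw [coeff, (rightMul_spec a b 1).eq h, id]

lemma rightOp_single_one (a b : K) (i j : Fin n) :
    rightOp a b i j (Pi.single 1 1) = leftOp a b i j (Pi.single 1 1) := by
  funext u
  have hone : u * swap i j = 1 ↔ swap i j * u = 1 := by
    rw [mul_eq_one_iff_eq_inv, mul_eq_one_iff_inv_eq, swap_inv, eq_comm]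
  by_cases h1 : u = 1
  · subst h1
    simp [leftOp, rightOp]
  by_cases h2 : swap i j * u = 1
  · have h3 := hone.2 h2
    have h4 : u = swap i j := by
      rw [mul_eq_one_iff_inv_eq, swap_inv] at h2
      exact h2.symm
    have h5 : u⁻¹ = u := by rw [h4, swap_inv]
    simp only [leftOp, rightOp, h2, h3, h5]
  · have h3 : ¬ u * swap i j = 1 := fun h => h2 (hone.1 h)
    simp [leftOp, rightOp, h1, h2, h3]

/-- Uniqueness of right multiplication lets any descent s of v be split off as `rightOp`; on the
delta function at 1 this equals `leftOp`, which then commutes outwards. -/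
lemma coeff_eq_leftOp (a b : K) {i j : Fin n} (hij : (j : ℕ) = i + 1) {v : Perm (Fin n)}
    (hd : v⁻¹ j < v⁻¹ i) :
    (fun u => coeff a b u v) = leftOp a b i j fun u => coeff a b u (swap i j * v) := by
  have h := (rightMul_spec a b v).eq ((rightMul_spec a b _).step hij hd)
  calc (fun u => coeff a b u v) = rightMul a b v (Pi.single 1 1) := rfl
    _ = rightMul a b (swap i j * v) (rightOp a b i j (Pi.single 1 1)) := by rw [h]
    _ = _ := by rw [rightOp_single_one, (rightMul_spec a b _).comm i j hij]; rfl

lemma coeff_of_descent (a b : K) {i j : Fin n} (hij : (j : ℕ) = i + 1) {u v : Perm (Fin n)}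
    (hd : v⁻¹ j < v⁻¹ i) (hu : u⁻¹ j < u⁻¹ i) :
    coeff a b u v = coeff a b (swap i j * u) (swap i j * v) :=
  (congrFun (coeff_eq_leftOp a b hij hd) u).trans (leftOp_of_descent hu)

lemma coeff_of_ascent (a b : K) {i j : Fin n} (hij : (j : ℕ) = i + 1) {u v : Perm (Fin n)}
    (hd : v⁻¹ j < v⁻¹ i) (hu : u⁻¹ i < u⁻¹ j) :
    coeff a b u v = a * coeff a b u (swap i j * v) + b * coeff a b (swap i j * u) (swap i j * v) :=
  (congrFun (coeff_eq_leftOp a b hij hd) u).trans (leftOp_of_ascent hu)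

/-- Induction on the number of inversions along left descents. -/
lemma descent_induction {P : Perm (Fin n) → Prop} (one : P 1)
    (step : ∀ (v : Perm (Fin n)) (i j : Fin n), (j : ℕ) = i + 1 → v⁻¹ j < v⁻¹ i →
      P (swap i j * v) → P v) (v : Perm (Fin n)) : P v := by
  induction hk : inv v using Nat.strong_induction_on generalizing v with
  | _ k ih =>
    by_cases hv : v = 1
    · rwa [hv]
    obtain ⟨i, j, hij, hd⟩ := exists_descent hv
    have := inv_of_descent hij hd
    exact step v i j hij hd (ih _ (by omega) _ rfl)

lemma coeff_self (a b : K) (v : Perm (Fin n)) : coeff a b v v = 1 := by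
  induction v using descent_induction with
  | one => simpa using congrFun (coeff_one (n := n) a b) 1
  | step v i j hij hd ih => rw [coeff_of_descent a b hij hd hd, ih]

lemma coeff_eq_zero (a b : K) {u v : Perm (Fin n)} (h : ¬ LE u v) : coeff a b u v = 0 := by
  induction v using descent_induction generalizing u with
  | one =>
    have hu : u ≠ 1 := by
      rintro rfl
      exact h .refl
    simpa [hu] using congrFun (coeff_one (n := n) a b) u
  | step v i j hij hd ih =>
    have ha : (swap i j * v)⁻¹ i < (swap i j * v)⁻¹ j := by simpa using hd
    have h1 : ¬ LE u (swap i j * v) := fun hle => h (by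
      have := Relation.ReflTransGen.tail hle (edge_of_ascent hij ha)
      rwa [swap_mul_self_mul] at this)
    have h2 : ¬ LE (swap i j * u) (swap i j * v) := fun hle => h (by
      have := hle.lift hij ha
      simpa using this)
    rcases descent_or_ascent hij u with hu | hu
    · rw [coeff_of_descent a b hij hd hu, ih h2]
    · rw [coeff_of_ascent a b hij hd hu, ih h1, ih h2]
      simp

/-! ### Identifying R and R̃ -/

lemma isRFamily_coeff : IsRFamily n (coeff (X - 1 : ℤ[X]) X) where
  of_not_le _ _ h := coeff_eq_zero _ _ h
  self u := coeff_self _ _ u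
  of_descent u v _ s hs hv hu := by
    obtain ⟨i, j, hij, rfl⟩ := hs
    exact coeff_of_descent _ _ hij ((lt_iff_descent hij).1 hv) ((lt_iff_descent hij).1 hu)
  of_ascent u v _ s hs hv hu := by
    obtain ⟨i, j, hij, rfl⟩ := hs
    exact coeff_of_ascent _ _ hij ((lt_iff_descent hij).1 hv) ((lt_iff_ascent hij).1 hu)

lemma IsRFamily.eq {F G : Perm (Fin n) → Perm (Fin n) → ℤ[X]} (hF : IsRFamily n F)
    (hG : IsRFamily n G) : F = G := by
  suffices ∀ v u, F u v = G u v from funext fun u => funext fun v => this v u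
  intro v
  induction hk : inv v using Nat.strong_induction_on generalizing v with
  | _ k ih =>
    intro u
    by_cases hle : LE u v
    swap
    · rw [hF.of_not_le _ _ hle, hG.of_not_le _ _ hle]
    by_cases huv : u = v
    · rw [huv, hF.self, hG.self]
    have hlt : LT u v := ⟨hle, huv⟩
    have hv : v ≠ 1 := by
      rintro rfl
      have := hlt.length_lt
      rw [length_eq_inv 1, inv_one] at this
      omega
    obtain ⟨i, j, hij, hd⟩ := exists_descent hv
    have hs : swap i j ∈ simples n := ⟨i, j, hij, rfl⟩
    have hd' := (lt_iff_descent hij).2 hd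
    have hlen := inv_of_descent hij hd
    have ih' := ih _ (by omega) (swap i j * v) rfl
    rcases descent_or_ascent hij u with hu | hu
    · have hu' := (lt_iff_descent hij).2 hu
      rw [hF.of_descent u v hlt _ hs hd' hu', hG.of_descent u v hlt _ hs hd' hu', ih']
    · have hu' := (lt_iff_ascent hij).2 hu
      rw [hF.of_ascent u v hlt _ hs hd' hu', hG.of_ascent u v hlt _ hs hd' hu', ih', ih']

lemma R_eq_coeff : (R : Perm (Fin n) → Perm (Fin n) → ℤ[X]) = coeff (X - 1) X :=
  (Classical.epsilon_spec (p := IsRFamily n) ⟨_, isRFamily_coeff⟩).eq isRFamily_coeff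

-- With q = T², the two recursions match because T² - 1 = T (T - T⁻¹).
open LaurentPolynomial in
lemma isRTilde_coeff (u v : Perm (Fin n)) : IsRTilde u v (coeff X 1 u v) := by
  rw [IsRTilde, R_eq_coeff, length_eq_inv, length_eq_inv]
  induction v using descent_induction generalizing u with
  | one =>
    have h1 := congrFun (coeff_one (n := n) (X - 1 : ℤ[X]) X) u
    have h2 := congrFun (coeff_one (n := n) (X : ℤ[X]) 1) u
    by_cases hu : u = 1
    · subst hu
      simp [h1, h2]
    · simp [h1, h2, hu]
  | step v i j hij hd ih =>
    have hv := inv_of_descent hij hd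
    rcases descent_or_ascent hij u with hu | hu
    · have hu' := inv_of_descent hij hu
      rw [coeff_of_descent _ _ hij hd hu, coeff_of_descent _ _ hij hd hu, ih, hv, hu']
      congr 2
      push_cast
      ring
    · have hu' := inv_of_ascent hij hu
      rw [coeff_of_ascent _ _ hij hd hu, coeff_of_ascent _ _ hij hd hu]
      simp only [map_add, map_mul, map_sub, aeval_X, map_one, one_mul, ih, hv, hu']
      set d : ℤ := (inv (swap i j * v) : ℤ) - inv u with hd
      have e1 : (((inv (swap i j * v) + 1 : ℕ) : ℤ) - inv u) = d + 1 := by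
        push_cast; ring
      have e2 : ((inv (swap i j * v) : ℤ) - ((inv u + 1 : ℕ) : ℤ)) = d - 1 := by
        push_cast; ring
      have e3 : (T 2 : LaurentPolynomial ℤ) * T (d - 1) = T (d + 1) := by
        rw [← T_add]; congr 1; ring
      have e4 : (T 2 - 1 : LaurentPolynomial ℤ) * T d = T (d + 1) * (T 1 - T (-1)) := by
        rw [sub_mul, mul_sub, ← T_add, ← T_add, ← T_add, one_mul]
        congr 2 <;> ring
      rw [e1, e2, ← mul_assoc, ← mul_assoc, e3, e4]
      ring

-- A polynomial in the kernel vanishes at x - x⁻¹ for x = 1, 2, 3, …, which are infinitely many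
-- rationals.
open LaurentPolynomial in
lemma aeval_T_sub_T_injective :
    Function.Injective (aeval (T 1 - T (-1) : LaurentPolynomial ℤ) : ℤ[X] → LaurentPolynomial ℤ) := by
  rw [injective_iff_map_eq_zero]
  intro P hP
  have key : ∀ x : ℚˣ, (P.map (Int.castRingHom ℚ)).eval ((x : ℚ) - ((x⁻¹ : ℚˣ) : ℚ)) = 0 := by
    intro x
    have h := congrArg (LaurentPolynomial.eval₂ (Int.castRingHom ℚ) x) hP
    rw [map_zero, aeval_def, Polynomial.hom_eval₂] at h
    rw [Polynomial.eval_map, ← h]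
    congr 1
    · exact RingHom.ext_int _ _
    · simp
  have hinj : Function.Injective fun k : ℕ => ((k : ℚ) + 1) - ((k : ℚ) + 1)⁻¹ := by
    refine (strictMono_nat_of_lt_succ fun k => ?_).injective
    have h : ((k : ℚ) + 1 + 1)⁻¹ ≤ ((k : ℚ) + 1)⁻¹ :=
      inv_anti₀ (by positivity) (by linarith)
    push_cast
    linarith
  have hz : P.map (Int.castRingHom ℚ) = 0 := by
    refine Polynomial.eq_zero_of_infinite_isRoot _ ((Set.infinite_range_of_injective hinj).mono ?_)
    rintro _ ⟨k, rfl⟩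
    have := key (Units.mk0 ((k : ℚ) + 1) (by positivity))
    simpa [Polynomial.IsRoot] using this
  exact (Polynomial.map_eq_zero_iff (Int.castRingHom ℚ).injective_int).1 hz

lemma RTilde_eq_coeff (u v : Perm (Fin n)) : RTilde u v = coeff X 1 u v := by
  have h1 := isRTilde_coeff u v
  have h2 : IsRTilde u v (RTilde u v) := Classical.epsilon_spec ⟨_, h1⟩
  rw [IsRTilde] at h1 h2
  exact aeval_T_sub_T_injective ((LaurentPolynomial.isUnit_T _).mul_left_cancel (h2.symm.trans h1))

lemma RTilde_eq_zero {u v : Perm (Fin n)} (h : ¬ LE u v) : RTilde u v = 0 := by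
  rw [RTilde_eq_coeff, coeff_eq_zero _ _ h]

/-! ### Inversion formula -/

/-- The inversion formula for the `R̃`-polynomials. -/
lemma sum_RTilde_comp_neg_mul (x v : Perm (Fin n)) :
    ∑ y, (RTilde x y).comp (-X) * RTilde y v = if x = v then 1 else 0 := by
  simp only [RTilde_eq_coeff]
  induction v using descent_induction generalizing x with
  | one =>
    simp only [fun u => congrFun (coeff_one (n := n) (X : ℤ[X]) 1) u, Pi.single_apply, mul_ite, mul_one, mul_zero, Finset.sum_ite_eq',
      Finset.mem_univ, if_true]
    split_ifs <;> simp
  | step v i j hij hd ih =>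
    have hne : ∀ y : Perm (Fin n), y⁻¹ j < y⁻¹ i ∨ y⁻¹ i < y⁻¹ j := descent_or_ascent hij
    set c : Perm (Fin n) → Perm (Fin n) → ℤ[X] := fun x y => (coeff X 1 x y).comp (-X) with hc
    -- `y ↦ c x (s y)` in terms of `c x y` and `c (s x) y`
    have hcol : ∀ y, c x (swap i j * y) + (if y⁻¹ j < y⁻¹ i then 0 else X * c x y) =
        c (swap i j * x) y + (if x⁻¹ j < x⁻¹ i then X * c x y else 0) := by
      intro y
      rcases hne y with hy | hy <;> rcases hne x with hx | hx
      · have h1 := coeff_of_ascent (X : ℤ[X]) 1 hij (u := swap i j * x) (v := y) hy (by simpa using hx)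
        have h2 := coeff_of_descent (X : ℤ[X]) 1 hij hy hx
        simp only [hc, hy, hx, if_true, h1, h2, swap_mul_self_mul]
        simp
      · have h1 := coeff_of_descent (X : ℤ[X]) 1 hij (u := swap i j * x) (v := y) hy (by simpa using hx)
        simp only [hc, hy, hx.not_gt, if_true, if_false, h1, swap_mul_self_mul]
      · have h1 := coeff_of_descent (X : ℤ[X]) 1 hij (u := x) (v := swap i j * y) (by simpa using hy) hx
        simp only [hc, hy.not_gt, hx, if_true, if_false, h1, swap_mul_self_mul]
      · have h1 := coeff_of_ascent (X : ℤ[X]) 1 hij (u := x) (v := swap i j * y) (by simpa using hy) hx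
        simp only [hc, hy.not_gt, hx.not_gt, if_false, h1, swap_mul_self_mul]
        simp
    set g : Perm (Fin n) → ℤ[X] := fun y => coeff X 1 y (swap i j * v) with hg
    have hrow : ∀ y, coeff X 1 y v = g (swap i j * y) + (if y⁻¹ j < y⁻¹ i then 0 else X * g y) := by
      intro y
      rcases hne y with hy | hy
      · rw [coeff_of_descent _ _ hij hd hy, if_pos hy, add_zero]
      · rw [coeff_of_ascent _ _ hij hd hy, if_neg hy.not_gt, one_mul, add_comm]
    have hre : ∑ y, c x y * g (swap i j * y) = ∑ y, c x (swap i j * y) * g y :=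
      Fintype.sum_equiv (Equiv.mulLeft (swap i j)) _ _ fun y => by simp
    calc ∑ y, c x y * coeff X 1 y v
        = ∑ y, (c x (swap i j * y) + (if y⁻¹ j < y⁻¹ i then 0 else X * c x y)) * g y := by
          simp only [hrow, mul_add, add_mul, Finset.sum_add_distrib, hre]
          congr 1
          refine Finset.sum_congr rfl fun y _ => ?_
          split_ifs <;> ring
      _ = ∑ y, c (swap i j * x) y * g y +
            (if x⁻¹ j < x⁻¹ i then X else 0) * ∑ y, c x y * g y := by
          simp only [hcol, add_mul, Finset.sum_add_distrib, Finset.mul_sum]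
          congr 1
          refine Finset.sum_congr rfl fun y _ => ?_
          split_ifs <;> ring
      _ = if x = v then 1 else 0 := by
          simp only [hc, hg, ih, mul_right_inj]
          -- The correction term would require x = s v, but s is an ascent of s v.
          have : ¬ (x⁻¹ j < x⁻¹ i ∧ x = swap i j * v) := by
            rintro ⟨h, rfl⟩
            simp only [swap_mul_inv_apply, swap_apply_left, swap_apply_right] at h
            exact lt_asymm h hd
          have h2 : (if x⁻¹ j < x⁻¹ i then X else 0 : ℤ[X]) *
              (if x = swap i j * v then 1 else 0) = 0 := by
            split_ifs with h3 h4
            · exact absurd ⟨h3, h4⟩ this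
            all_goals simp
          rw [h2, add_zero]

end SymBruhat

/-! ### The sum over an order ideal -/

theorem lemma3p4 (n : ℕ) (u v : Equiv.Perm (Fin n)) (huv : SymBruhat.LE u v)
    (I : Finset (Equiv.Perm (Fin n))) (hI : SymBruhat.IsOrderIdeal u v I)
    (hne : I.Nonempty) (hproper : I ≠ SymBruhat.interval u v) :
    ∑ y ∈ SymBruhat.interval u v,
      (SymBruhat.relRTilde u y I).comp (-Polynomial.X) * SymBruhat.RTilde y v = 0 := by
  have mem_int : ∀ {a b c : Equiv.Perm (Fin n)},
      c ∈ SymBruhat.interval a b ↔ SymBruhat.LE a c ∧ SymBruhat.LE c b := by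
    simp [SymBruhat.interval]
  have hvI : v ∉ I := by
    intro hv
    refine hproper (Finset.Subset.antisymm hI.1 fun x hx => ?_)
    exact hI.2 x hx v hv (mem_int.1 hx).2
  have hrel : ∀ y, (SymBruhat.relRTilde u y I).comp (-X) =
      ∑ x ∈ I, SymBruhat.RTilde u x * (SymBruhat.RTilde x y).comp (-X) := by
    intro y
    rw [SymBruhat.relRTilde, Polynomial.sum_comp]
    refine (Finset.sum_congr rfl fun x _ => ?_).trans
      (Finset.sum_subset Finset.inter_subset_left fun x hx hx' => ?_)
    · rw [Polynomial.mul_comp, Polynomial.comp_assoc]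
      simp
    · have h : ¬ SymBruhat.LE x y := fun h =>
        hx' (Finset.mem_inter.2 ⟨hx, mem_int.2 ⟨(mem_int.1 (hI.1 hx)).1, h⟩⟩)
      rw [SymBruhat.RTilde_eq_zero h]
      simp
  calc ∑ y ∈ SymBruhat.interval u v,
        (SymBruhat.relRTilde u y I).comp (-X) * SymBruhat.RTilde y v
      = ∑ y, (SymBruhat.relRTilde u y I).comp (-X) * SymBruhat.RTilde y v := by
        -- A y outside [u,v] contributes nothing: either y ≰ v, or u ≰ y and then no x in I lies
        -- below y.
        refine Finset.sum_subset (Finset.subset_univ _) fun y _ hy => ?_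
        by_cases hyv : SymBruhat.LE y v
        · rw [hrel, Finset.sum_eq_zero, zero_mul]
          intro x hx
          have h : ¬ SymBruhat.LE x y := fun h =>
            hy (mem_int.2 ⟨Relation.ReflTransGen.trans (mem_int.1 (hI.1 hx)).1 h, hyv⟩)
          rw [SymBruhat.RTilde_eq_zero h]
          simp
        · rw [SymBruhat.RTilde_eq_zero hyv, mul_zero]
    _ = ∑ x ∈ I, SymBruhat.RTilde u x *
          ∑ y, (SymBruhat.RTilde x y).comp (-X) * SymBruhat.RTilde y v := by
        simp only [hrel, Finset.sum_mul, Finset.mul_sum, mul_assoc]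
        exact Finset.sum_comm
    _ = 0 := Finset.sum_eq_zero fun x hx => by
        rw [SymBruhat.sum_RTilde_comp_neg_mul, if_neg (ne_of_mem_of_not_mem hx hvI), mul_zero]
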